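/- Write $\mathbb{Z}_L=\{\dots,-2,-1\}$ and $\mathbb{Z}_R=\{0,1,2,\dots\}$. (Quantum spin lattice systems.) Let $\mathcal{A}_{\mathbb{Z}}$ be a quantum spin lattice system on $\mathbb{Z}$, i.e. a unital $C^*$-algebra with subalgebras $\mathcal{A}(I)$ ($I\subset\mathbb{Z}$ finite), each isomorphic to a full matrix algebra $M_k(\mathbb{C})$ for some $k\ge 1$, such that $\mathcal{A}(I\cup J)=\mathcal{A}(I)\otimes\mathcal{A}(J)$ (via $A\otimes B\mapsto AB$) for disjoint $I,J$, and such that $\bigcup_I\mathcal{A}(I)$ is norm dense. Let $\mathcal{A}_L$ (resp. $\mathcal{A}_R$) be the $C^*$-subalgebra generated by all $\mathcal{A}(I)$ with $I\subset\mathbb{Z}_L$ (resp. $I\subset\mathbb{Z}_R$) finite. Then for every $*$-automorphism $\alpha_L$ of $\mathcal{A}_L$ and every $*$-automorphism $\alpha_R$ of $\mathcal{A}_R$ there exists a $*$-automorphism $\alpha_L\otimes\alpha_R$ of $\mathcal{A}_{\mathbb{Z}}$ such that $$(\alpha_L\otimes\alpha_R)\Bigl(\sum_k A_kB_k\Bigr)=\sum_k\alpha_L(A_k)\,\alpha_R(B_k)$$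 for every finite sum with $A_k\in\mathcal{A}_L$ and $B_k\in\mathcal{A}_R$. (Fermion lattice systems.) Let $\mathcal{A}_{\mathbb{Z}}$ be a fermion lattice system on $\mathbb{Z}$, i.e. a nonzero unital $C^*$-algebra in which the $*$-algebra generated by elements $c_i$, $i\in\mathbb{Z}$, is norm dense, where $c_i^*c_j+c_jc_i^*=\delta_{ij}1$ and $c_ic_j+c_jc_i=0=c_i^*c_j^*+c_j^*c_i^*$. Let $\mathcal{A}_L$ (resp. $\mathcal{A}_R$) be the $C^*$-subalgebra generated by the $c_i$ with $i\in\mathbb{Z}_L$ (resp. $i\in\mathbb{Z}_R$), and let $\Theta_L$ (resp. $\Theta_R$) be its grading, the involutive $*$-automorphism of it determined by $\Theta_L(c_i)=-c_i$, $i\in\mathbb{Z}_L$ (resp. $\Theta_R(c_i)=-c_i$, $i\in\mathbb{Z}_R$). Let $\alpha_L$ and $\alpha_R$ be $*$-automorphisms of $\mathcal{A}_L$ and $\mathcal{A}_R$ with $\alpha_L\Theta_L=\Theta_L\alpha_L$ and $\alpha_R\Theta_R=\Theta_R\alpha_R$. Then there exists a $*$-automorphism $\alpha_L\otimes_{\mathrm{car}}\alpha_R$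 of $\mathcal{A}_{\mathbb{Z}}$ such that $$(\alpha_L\otimes_{\mathrm{car}}\alpha_R)\Bigl(\sum_k A_kB_k\Bigr)=\sum_k\alpha_L(A_k)\,\alpha_R(B_k)$$ for every finite sum with $A_k\in\mathcal{A}_L$ and $B_k\in\mathcal{A}_R$. -/

import Mathlib

open scoped TensorProduct Topology
open Filter

/-! ### Quantum spin lattice systems -/

/-- A quantum spin lattice system on the lattice `Γ`: a unital C⋆-algebra `A` together with
subalgebras `A(I)` for finite `I ⊆ Γ`, each of them a full matrix algebra, such that
`A(I ∪ J) = A(I) ⊗ A(J)` for disjoint `I`, `J`, and such that the local algebra `⋃ A(I)` is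
norm dense in `A`. -/
structure QuantumSpinSystem (Γ : Type*) [DecidableEq Γ] (A : Type*) [CStarAlgebra A] where
  /-- the subsystem `A(I)` of a finite region `I` -/
  loc : Finset Γ → StarSubalgebra ℂ A
  /-- `A(I)` is ⋆-isomorphic to some full matrix algebra `M_k(ℂ)`, `k ≥ 1`. -/
  loc_matrix : ∀ I : Finset Γ, ∃ k : ℕ, 0 < k ∧
    Nonempty (loc I ≃⋆ₐ[ℂ] Matrix (Fin k) (Fin k) ℂ)
  /-- For disjoint `I`, `J` the map `a ⊗ b ↦ a b` is an isomorphism of algebras from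
  `A(I) ⊗ A(J)` onto `A(I ∪ J)`; in particular `A(I)` and `A(J)` commute. -/
  loc_tensor : ∀ I J : Finset Γ, Disjoint I J →
    ∃ e : (loc I ⊗[ℂ] loc J) ≃ₐ[ℂ] loc (I ∪ J),
      ∀ (a : loc I) (b : loc J), (e (a ⊗ₜ[ℂ] b) : A) = (a : A) * (b : A)
  /-- The local algebra is norm dense. -/
  dense_loc : Dense (⋃ I : Finset Γ, (loc I : Set A))

/-- The subsystem `A(I)` of an arbitrary (possibly infinite) region `I`: the C⋆-subalgebra
generated by all `A(J)`, `J ⊆ I` finite. -/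
noncomputable def QuantumSpinSystem.region {Γ : Type*} [DecidableEq Γ] {A : Type*}
    [CStarAlgebra A] (S : QuantumSpinSystem Γ A) (I : Set Γ) : StarSubalgebra ℂ A :=
  (⨆ J : {J : Finset Γ // (J : Set Γ) ⊆ I}, S.loc J.1).topologicalClosure

/-! ### Fermion lattice systems -/

/-- A (spinless) fermion lattice system on the lattice `Γ`: a nonzero unital C⋆-algebra `A` with
annihilation operators `c i`, `i ∈ Γ`, that satisfy the canonical anticommutation relations,
such that the ⋆-algebra generated by all `c i` (the local algebra) is norm dense in `A`. -/
structure IsFermionSystem {Γ : Type*} [DecidableEq Γ] {A : Type*} [CStarAlgebra A]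
    (c : Γ → A) : Prop where
  one_ne_zero : (1 : A) ≠ 0
  /-- `{c_i⋆, c_j} = δ_{ij} 1` -/
  star_anticomm : ∀ i j, star (c i) * c j + c j * star (c i) = if i = j then 1 else 0
  /-- `{c_i, c_j} = 0` -/
  anticomm : ∀ i j, c i * c j + c j * c i = 0
  /-- `{c_i⋆, c_j⋆} = 0` -/
  star_star_anticomm : ∀ i j, star (c i) * star (c j) + star (c j) * star (c i) = 0
  dense_adjoin : Dense (StarAlgebra.adjoin ℂ (Set.range c) : Set A)

/-- The subsystem `A(I)` of an arbitrary (finite or infinite) region `I`: the C⋆-subalgebra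
generated by `c i`, `i ∈ I`. -/
noncomputable def fermionRegion {Γ : Type*} {A : Type*} [CStarAlgebra A] (c : Γ → A)
    (I : Set Γ) : StarSubalgebra ℂ A :=
  (StarAlgebra.adjoin ℂ (c '' I)).topologicalClosure

theorem mem_fermionRegion {Γ : Type*} {A : Type*} [CStarAlgebra A] (c : Γ → A)
    {I : Set Γ} {i : Γ} (hi : i ∈ I) : c i ∈ fermionRegion c I :=
  StarSubalgebra.le_topologicalClosure _
    (StarAlgebra.subset_adjoin ℂ _ (Set.mem_image_of_mem c hi))

namespace IsFermionSystem

variable {Γ : Type*} [DecidableEq Γ] {A : Type*} [CStarAlgebra A] {c : Γ → A}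

/-- The inner automorphism by the unitary `1 - 2 c_j⋆ c_j` flips the sign of `c_j` and fixes the
other annihilation operators. -/
theorem exists_flip (h : IsFermionSystem c) (j : Γ) :
    ∃ φ : A ≃⋆ₐ[ℂ] A, φ (c j) = -c j ∧ ∀ i, i ≠ j → φ (c i) = c i := by
  have hsq : c j * c j = 0 := by
    have := h.anticomm j j
    rw [← two_smul ℂ (c j * c j)] at this
    exact (smul_eq_zero.mp this).resolve_left two_ne_zero
  have hcar : c j * star (c j) = 1 - star (c j) * c j := by
    have := h.star_anticomm j j
    rw [if_pos rfl] at this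
    exact eq_sub_of_add_eq' this
  have hccc : c j * star (c j) * c j = c j := by
    rw [hcar, sub_mul, one_mul, mul_assoc, hsq, mul_zero, sub_zero]
  set n := star (c j) * c j with hn
  have hnn : n * n = n := by
    rw [hn, mul_assoc, ← mul_assoc (c j), hccc]
  have hns : star n = n := by rw [hn, star_mul, star_star]
  have huu : (1 - 2 * n) * (1 - 2 * n) = 1 := by
    have : (1 - 2 * n) * (1 - 2 * n) = 1 - 4 * n + 4 * (n * n) := by noncomm_ring
    rw [this, hnn]; noncomm_ring
  have hus : star (1 - 2 * n) = 1 - 2 * n := by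
    have : (2 : A) * n = n + n := two_mul n
    rw [this, star_sub, star_add, star_one, hns]
  have hu : (1 - 2 * n) ∈ unitary A := by
    rw [Unitary.mem_iff, hus]; exact ⟨huu, huu⟩
  refine ⟨Unitary.conjStarAlgAut ℂ A ⟨_, hu⟩, ?_, ?_⟩
  · have h1 : n * c j = 0 := by rw [hn, mul_assoc, hsq, mul_zero]
    have h2 : c j * n = c j := by rw [hn, ← mul_assoc, hccc]
    rw [Unitary.conjStarAlgAut_apply]
    change (1 - 2 * n) * c j * star (1 - 2 * n) = _
    rw [hus, sub_mul, mul_assoc 2, h1, mul_zero, sub_zero, one_mul, mul_sub, two_mul, mul_add,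
      h2, mul_one]
    abel
  · intro i hij
    have e1 : c i * star (c j) = -(star (c j) * c i) := by
      have := h.star_anticomm j i
      rw [if_neg (Ne.symm hij)] at this
      exact eq_neg_of_add_eq_zero_right this
    have e2 : c j * c i = -(c i * c j) := eq_neg_of_add_eq_zero_right (h.anticomm i j)
    have h3 : c i * n = n * c i := by
      rw [hn, ← mul_assoc, e1, mul_assoc, e2]; simp [mul_assoc]
    have h4 : (1 - 2 * n) * c i = c i * (1 - 2 * n) := by
      rw [two_mul, sub_mul, mul_sub, add_mul, mul_add, h3, one_mul, mul_one]
    rw [Unitary.conjStarAlgAut_apply]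
    change (1 - 2 * n) * c i * star (1 - 2 * n) = _
    rw [hus, h4, mul_assoc, huu, mul_one]

theorem exists_flip_finset (h : IsFermionSystem c) (s : Finset Γ) :
    ∃ φ : A ≃⋆ₐ[ℂ] A, (∀ i ∈ s, φ (c i) = -c i) ∧ ∀ i, i ∉ s → φ (c i) = c i := by
  induction s using Finset.induction_on with
  | empty => exact ⟨StarAlgEquiv.refl ℂ A, by simp, fun i _ => rfl⟩
  | insert j s hj ih =>
    obtain ⟨φ, h1, h2⟩ := ih
    obtain ⟨ψ, k1, k2⟩ := h.exists_flip j
    refine ⟨φ.trans ψ, ?_, ?_⟩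
    · intro i hi
      rw [StarAlgEquiv.trans_apply]
      rcases Finset.mem_insert.mp hi with rfl | hi
      · rw [h2 _ hj, k1]
      · rw [h1 i hi, map_neg, k2 i (fun e => hj (e ▸ hi))]
    · intro i hi
      rw [Finset.mem_insert, not_or] at hi
      rw [StarAlgEquiv.trans_apply, h2 i hi.2, k2 i hi.1]

/-- Existence of the fermion grading on the whole system. -/
theorem exists_starAlgHom (h : IsFermionSystem c) :
    ∃ Θ : A →⋆ₐ[ℂ] A, ∀ i, Θ (c i) = -c i := by
  choose φ h1 h2 using h.exists_flip_finset
  have hiso : ∀ s a, ‖φ s a‖ = ‖a‖ := fun s a =>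
    NonUnitalStarAlgHom.norm_map (φ s) (φ s).injective a
  have halg : ∀ a ∈ StarAlgebra.adjoin ℂ (Set.range c),
      ∃ b, Tendsto (fun s => φ s a) atTop (𝓝 b) := by
    intro a ha
    induction ha using StarAlgebra.adjoin_induction with
    | mem x hx =>
      obtain ⟨i, rfl⟩ := hx
      refine ⟨-c i, tendsto_const_nhds.congr' ?_⟩
      filter_upwards [eventually_ge_atTop {i}] with s hs
      exact (h1 s i (hs (Finset.mem_singleton_self i))).symm
    | algebraMap r => exact ⟨algebraMap ℂ A r, by simp [AlgHomClass.commutes]⟩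
    | add x y _ _ hx hy =>
      obtain ⟨b, hb⟩ := hx
      obtain ⟨d, hd⟩ := hy
      exact ⟨b + d, by simpa using hb.add hd⟩
    | mul x y _ _ hx hy =>
      obtain ⟨b, hb⟩ := hx
      obtain ⟨d, hd⟩ := hy
      exact ⟨b * d, by simpa using hb.mul hd⟩
    | star x _ hx =>
      obtain ⟨b, hb⟩ := hx
      exact ⟨star b, by simpa [map_star] using hb.star⟩
  have hall : ∀ a, ∃ b, Tendsto (fun s => φ s a) atTop (𝓝 b) := by
    intro a
    apply cauchySeq_tendsto_of_complete
    rw [Metric.cauchySeq_iff']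
    intro ε hε
    obtain ⟨x, hx, hax⟩ := Metric.dense_iff.mp h.dense_adjoin a (ε / 3) (by positivity)
    obtain ⟨b, hb⟩ := halg x hax
    obtain ⟨N, hN⟩ := (Metric.cauchySeq_iff'.mp hb.cauchySeq) (ε / 3) (by positivity)
    refine ⟨N, fun s hs => ?_⟩
    have hd : ∀ t, dist (φ t a) (φ t x) < ε / 3 := fun t => by
      rw [dist_eq_norm, ← map_sub, hiso, ← dist_eq_norm, dist_comm]
      exact hx
    have t1 := dist_triangle4 (φ s a) (φ s x) (φ N x) (φ N a)
    have t2 := hd s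
    have t3 := hd N
    rw [dist_comm] at t3
    have t4 := hN s hs
    linarith
  choose Θ hΘ using hall
  refine ⟨{ toFun := Θ
            map_one' := tendsto_nhds_unique (hΘ 1) (by simp)
            map_mul' := fun x y => tendsto_nhds_unique (hΘ _) (by simpa using (hΘ x).mul (hΘ y))
            map_zero' := tendsto_nhds_unique (hΘ 0) (by simp)
            map_add' := fun x y => tendsto_nhds_unique (hΘ _) (by simpa using (hΘ x).add (hΘ y))
            commutes' := fun r => tendsto_nhds_unique (hΘ _) (by simp [AlgHomClass.commutes])
            map_star' := fun x => tendsto_nhds_unique (hΘ _)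
              (by simpa [map_star] using (hΘ x).star) }, fun i => ?_⟩
  refine tendsto_nhds_unique (hΘ (c i)) (tendsto_const_nhds.congr' ?_)
  filter_upwards [eventually_ge_atTop {i}] with s hs
  exact (h1 s i (hs (Finset.mem_singleton_self i))).symm

/-- Existence of the fermion grading of a region. -/
theorem exists_grading (h : IsFermionSystem c) (I : Set Γ) :
    ∃ Θ : fermionRegion c I ≃⋆ₐ[ℂ] fermionRegion c I, ∀ (i : Γ) (hi : i ∈ I),
      Θ ⟨c i, mem_fermionRegion c hi⟩ = -⟨c i, mem_fermionRegion c hi⟩ := by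
  obtain ⟨Θ, hΘ⟩ := h.exists_starAlgHom
  have hcont : Continuous Θ :=
    AddMonoidHomClass.continuous_of_bound Θ 1 fun x => by
      simpa using NonUnitalStarAlgHom.norm_apply_le Θ x
  have hmem : ∀ x ∈ fermionRegion c I, Θ x ∈ fermionRegion c I := by
    have : fermionRegion c I ≤ (fermionRegion c I).comap Θ := by
      refine StarSubalgebra.topologicalClosure_minimal (StarAlgebra.adjoin_le ?_)
        ((StarSubalgebra.isClosed_topologicalClosure _).preimage hcont)
      rintro _ ⟨i, hi, rfl⟩
      change Θ (c i) ∈ fermionRegion c I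
      rw [hΘ]
      exact neg_mem (mem_fermionRegion c hi)
    exact this
  have hinv : ∀ x, Θ (Θ x) = x := by
    have hadj : ∀ a ∈ StarAlgebra.adjoin ℂ (Set.range c), Θ (Θ a) = a := by
      intro a ha
      induction ha using StarAlgebra.adjoin_induction with
      | mem x hx => obtain ⟨i, rfl⟩ := hx; rw [hΘ, map_neg, hΘ, neg_neg]
      | algebraMap r => simp [AlgHomClass.commutes]
      | add x y _ _ hx hy => rw [map_add, map_add, hx, hy]
      | mul x y _ _ hx hy => rw [map_mul, map_mul, hx, hy]
      | star x _ hx => rw [map_star, map_star, hx]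
    exact congrFun (Continuous.ext_on h.dense_adjoin (hcont.comp hcont) continuous_id hadj)
  let f : fermionRegion c I →⋆ₐ[ℂ] fermionRegion c I :=
    (Θ.comp (fermionRegion c I).subtype).codRestrict _ (fun x => hmem x x.2)
  have hf : f.comp f = .id ℂ _ := by
    ext x
    exact hinv x
  refine ⟨.ofStarAlgHom f f hf hf, fun i hi => ?_⟩
  exact Subtype.ext (hΘ i)

/-- The fermion grading `Θ_I` of the region `I`: the involutive ⋆-automorphism of `A(I)` determined
by `Θ_I (c i) = -c i` for `i ∈ I` (hence also `Θ_I (c i⋆) = -c i⋆`). -/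
noncomputable def grading (h : IsFermionSystem c) (I : Set Γ) :
    fermionRegion c I ≃⋆ₐ[ℂ] fermionRegion c I :=
  (h.exists_grading I).choose

theorem grading_apply (h : IsFermionSystem c) (I : Set Γ) {i : Γ} (hi : i ∈ I) :
    h.grading I ⟨c i, mem_fermionRegion c hi⟩ = -⟨c i, mem_fermionRegion c hi⟩ :=
  (h.exists_grading I).choose_spec i hi

end IsFermionSystem

/-! ### The two halves of the chain and product extensions -/

/-- The left half `{…, -2, -1}` of `ℤ`. -/
def leftHalf : Set ℤ := Set.Iio 0

/-- The right half `{0, 1, 2, …}` of `ℤ`. -/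
def rightHalf : Set ℤ := Set.Ici 0

/-- `α` is a product extension of the automorphisms `αL` of `AL` and `αR` of `AR`:
`α (∑ A_k B_k) = ∑ αL(A_k) αR(B_k)` for all finite sums with `A_k ∈ AL` and `B_k ∈ AR`
(so that `α` restricts to `αL` on `AL` and to `αR` on `AR`). -/
def IsProductExtension {A : Type*} [CStarAlgebra A] {AL AR : StarSubalgebra ℂ A}
    (αL : AL ≃⋆ₐ[ℂ] AL) (αR : AR ≃⋆ₐ[ℂ] AR) (α : A ≃⋆ₐ[ℂ] A) : Prop :=
  ∀ (n : ℕ) (a : Fin n → AL) (b : Fin n → AR),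
    α (∑ k, (a k : A) * (b k : A)) = ∑ k, (αL (a k) : A) * (αR (b k) : A)

/-!
It suffices to extend an automorphism `α` of the algebra `A(I)` of a region to the whole system,
acting trivially on the complement: the composition of two such extensions is a product extension.
The candidate extension is given on a dense ⋆-subalgebra by its graph, the ⋆-algebra generated by
the pairs `(a, α a)` and `(x, x)` with `x` local in the complement. The graph defines an
automorphism as soon as its points satisfy `‖p.1‖ = ‖p.2‖`, which may be checked for `x` in one
finite full matrix algebra `C` at a time. If `C` commutes with `A(I)`, then both coordinates are
images of one and the same matrix over `A(I)` under injective, hence isometric, ⋆-homomorphisms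
`X ↦ ∑ X i j e i j` and `X ↦ ∑ α (X i j) e i j`, where `e` are the matrix units of `C`.

This is the case for spins. For fermions `C` is still a matrix algebra, by the Jordan–Wigner
transformation, but it commutes with `A(I)` only up to signs. The Klein transform, which multiplies
the odd elements of `A(I)` by the parity `P ∈ C`, replaces `A(I)` by an isomorphic algebra that
commutes with `C`; it does not change the graph because `α` is even.
-/

/-! ### Extensions of automorphisms and their graphs -/

section StarSubalgebra

variable {R A : Type*} [CommSemiring R] [StarRing R] [Semiring A] [StarRing A] [Algebra R A]
  [StarModule R A]

theorem isClosed_starSubalgebra_centralizer [TopologicalSpace A] [ContinuousMul A] [T2Space A]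
    (s : Set A) : IsClosed (StarSubalgebra.centralizer R s : Set A) := by
  rw [StarSubalgebra.coe_centralizer]
  exact Set.isClosed_centralizer _

theorem range_starSubalgebra_subtype (S : StarSubalgebra R A) : S.subtype.range = S := by
  ext x
  exact ⟨fun ⟨y, hy⟩ => hy ▸ y.2, fun hx => ⟨⟨x, hx⟩, rfl⟩⟩

theorem commute_of_mem_adjoin_of_mem_adjoin {s t : Set A}
    (h : ∀ x ∈ s, ∀ y ∈ t, Commute x y ∧ Commute x (star y)) {x y : A}
    (hx : x ∈ StarAlgebra.adjoin R s) (hy : y ∈ StarAlgebra.adjoin R t) : Commute x y := by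
  have ht : StarAlgebra.adjoin R t ≤ StarSubalgebra.centralizer R s := by
    refine StarAlgebra.adjoin_le fun y hy => (StarSubalgebra.mem_centralizer_iff R).mpr
      fun x hx => ⟨(h x hx y hy).1.eq, ?_⟩
    simpa using (h x hx y hy).2.star_star.eq
  exact (((StarSubalgebra.mem_centralizer_iff R).mp
    (StarAlgebra.adjoin_le_centralizer_centralizer R s hx)) y (ht hy)).1.symm

end StarSubalgebra

theorem bijective_of_isometry_of_denseRange {X Y : Type*} [MetricSpace X] [CompleteSpace X]
    [MetricSpace Y] {f : X → Y} (hf : Isometry f) (hd : DenseRange f) : Function.Bijective f :=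
  ⟨hf.injective, Set.range_eq_univ.mp <| by
    rw [← hf.isClosedEmbedding.isClosed_range.closure_eq, hd.closure_range]⟩

theorem exists_starAlgEquiv_of_norm_fst_eq_norm_snd {A B : Type*} [CStarAlgebra A] [CStarAlgebra B]
    (R : StarSubalgebra ℂ (A × B)) (hR : ∀ p ∈ R, ‖p.1‖ = ‖p.2‖)
    (hfst : Dense (R.map (StarAlgHom.fst ℂ A B) : Set A))
    (hsnd : Dense (R.map (StarAlgHom.snd ℂ A B) : Set B)) :
    ∃ T : A ≃⋆ₐ[ℂ] B, ∀ p ∈ R, T p.1 = p.2 := by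
  let C := R.topologicalClosure
  have hRC : R ≤ C := R.le_topologicalClosure
  have hnorm : ∀ p ∈ C, ‖p.1‖ = ‖p.2‖ :=
    closure_minimal (t := {p : A × B | ‖p.1‖ = ‖p.2‖}) hR
      (isClosed_eq (by fun_prop) (by fun_prop))
  have bijective_fst : Function.Bijective ((StarAlgHom.fst ℂ A B).comp C.subtype) := by
    refine bijective_of_isometry_of_denseRange (AddMonoidHomClass.isometry_of_norm _ fun p => ?_)
      (hfst.mono ?_)
    · change ‖(p : A × B).1‖ = max ‖(p : A × B).1‖ ‖(p : A × B).2‖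
      rw [← hnorm p p.2, max_self]
    · rintro _ ⟨p, hp, rfl⟩
      exact ⟨⟨p, hRC hp⟩, rfl⟩
  have bijective_snd : Function.Bijective ((StarAlgHom.snd ℂ A B).comp C.subtype) := by
    refine bijective_of_isometry_of_denseRange (AddMonoidHomClass.isometry_of_norm _ fun p => ?_)
      (hsnd.mono ?_)
    · change ‖(p : A × B).2‖ = max ‖(p : A × B).1‖ ‖(p : A × B).2‖
      rw [hnorm p p.2, max_self]
    · rintro _ ⟨p, hp, rfl⟩
      exact ⟨⟨p, hRC hp⟩, rfl⟩
  refine ⟨(StarAlgEquiv.ofBijective _ bijective_fst).symm.trans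
    (StarAlgEquiv.ofBijective _ bijective_snd), fun p hp => ?_⟩
  have hp₁ : StarAlgEquiv.ofBijective _ bijective_fst ⟨p, hRC hp⟩ = p.1 := rfl
  rw [StarAlgEquiv.trans_apply, ← hp₁, StarAlgEquiv.symm_apply_apply]
  rfl

section ExtensionGraph

variable {A B : Type*} [CStarAlgebra A] [Ring B] [StarRing B] [Algebra ℂ B]

/-- The ⋆-algebra generated by the pairs `(ρ b, ρ (α b))` and `(x, x)` for `x ∈ C`: the graph, if
it is one, of the ⋆-homomorphism that acts as `α` on the image of `ρ` and trivially on `C`. -/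
def extensionGraph (ρ : B →⋆ₐ[ℂ] A) (α : B ≃⋆ₐ[ℂ] B) (C : StarSubalgebra ℂ A) :
    StarSubalgebra ℂ (A × A) :=
  StarAlgebra.adjoin ℂ (Set.range (fun b => (ρ b, ρ (α b))) ∪ (fun x => (x, x)) '' C)

variable {ρ : B →⋆ₐ[ℂ] A} {α : B ≃⋆ₐ[ℂ] B} {C D : StarSubalgebra ℂ A}

theorem apply_mem_extensionGraph (b : B) : (ρ b, ρ (α b)) ∈ extensionGraph ρ α C :=
  StarAlgebra.subset_adjoin ℂ _ (.inl ⟨b, rfl⟩)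

theorem diag_mem_extensionGraph {x : A} (hx : x ∈ C) : (x, x) ∈ extensionGraph ρ α C :=
  StarAlgebra.subset_adjoin ℂ _ (.inr ⟨x, hx, rfl⟩)

theorem extensionGraph_le {R : StarSubalgebra ℂ (A × A)} (hα : ∀ b, (ρ b, ρ (α b)) ∈ R)
    (hC : ∀ x ∈ C, (x, x) ∈ R) : extensionGraph ρ α C ≤ R :=
  StarAlgebra.adjoin_le <| Set.union_subset (Set.range_subset_iff.mpr hα)
    (Set.image_subset_iff.mpr hC)

theorem extensionGraph_mono (h : C ≤ D) : extensionGraph ρ α C ≤ extensionGraph ρ α D :=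
  extensionGraph_le apply_mem_extensionGraph fun _ hx => diag_mem_extensionGraph (h hx)

theorem range_sup_le_map_fst_extensionGraph :
    ρ.range ⊔ C ≤ (extensionGraph ρ α C).map (StarAlgHom.fst ℂ A A) := by
  refine sup_le ?_ fun x hx => ⟨_, diag_mem_extensionGraph hx, rfl⟩
  rintro _ ⟨b, rfl⟩
  exact ⟨_, apply_mem_extensionGraph b, rfl⟩

theorem range_sup_le_map_snd_extensionGraph :
    ρ.range ⊔ C ≤ (extensionGraph ρ α C).map (StarAlgHom.snd ℂ A A) := by
  refine sup_le ?_ fun x hx => ⟨_, diag_mem_extensionGraph hx, rfl⟩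
  rintro _ ⟨b, rfl⟩
  exact ⟨_, apply_mem_extensionGraph (α.symm b), congrArg ρ (α.apply_symm_apply b)⟩

theorem exists_extension_of_norm_eq {ι : Type*} [Nonempty ι] {C : ι → StarSubalgebra ℂ A}
    (hC : Directed (· ≤ ·) C)
    (hdense : Dense ((⨆ i, ρ.range ⊔ C i : StarSubalgebra ℂ A) : Set A))
    (hnorm : ∀ i, ∀ p ∈ extensionGraph ρ α (C i), ‖p.1‖ = ‖p.2‖) :
    ∃ T : A ≃⋆ₐ[ℂ] A, (∀ b, T (ρ b) = ρ (α b)) ∧ ∀ i, ∀ x ∈ C i, T x = x := by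
  let R : StarSubalgebra ℂ (A × A) := ⨆ i, extensionGraph ρ α (C i)
  have hdir : Directed (· ≤ ·) fun i => extensionGraph ρ α (C i) := fun i j =>
    (hC i j).imp fun _ h => ⟨extensionGraph_mono h.1, extensionGraph_mono h.2⟩
  have hle : ∀ i, extensionGraph ρ α (C i) ≤ R := le_iSup _
  have hR : ∀ p ∈ R, ‖p.1‖ = ‖p.2‖ := by
    intro p hp
    rw [← SetLike.mem_coe, StarSubalgebra.coe_iSup_of_directed hdir] at hp
    obtain ⟨i, hi⟩ := Set.mem_iUnion.mp hp
    exact hnorm i p hi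
  have hfst : ⨆ i, ρ.range ⊔ C i ≤ R.map (StarAlgHom.fst ℂ A A) := iSup_le fun i =>
    range_sup_le_map_fst_extensionGraph.trans (StarSubalgebra.map_mono (hle i))
  have hsnd : ⨆ i, ρ.range ⊔ C i ≤ R.map (StarAlgHom.snd ℂ A A) := iSup_le fun i =>
    range_sup_le_map_snd_extensionGraph.trans (StarSubalgebra.map_mono (hle i))
  obtain ⟨T, hT⟩ :=
    exists_starAlgEquiv_of_norm_fst_eq_norm_snd R hR (hdense.mono hfst) (hdense.mono hsnd)
  exact ⟨T, fun b => hT _ (hle (Classical.arbitrary ι) (apply_mem_extensionGraph b)),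
    fun i x hx => hT _ (hle i (diag_mem_extensionGraph hx))⟩

end ExtensionGraph

/-! ### Matrix units -/

/-- `e` is a complete system of matrix units in the ⋆-ring `A`. -/
structure IsMatrixUnits {n A : Type*} [Fintype n] [DecidableEq n] [Ring A] [StarRing A]
    (e : n → n → A) : Prop where
  mul : ∀ i j k l, e i j * e k l = if j = k then e i l else 0
  star : ∀ i j, star (e i j) = e j i
  sum : ∑ i, e i i = 1

namespace IsMatrixUnits

variable {m n A B : Type*} [Fintype m] [DecidableEq m] [Fintype n] [DecidableEq n]
  [Ring A] [StarRing A]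

theorem matrix_single [Ring B] [StarRing B] :
    IsMatrixUnits fun i j : n => Matrix.single i j (1 : B) where
  mul i j k l := by
    rcases eq_or_ne j k with rfl | hjk
    · simp
    · simp [hjk]
  star i j := by simp [Matrix.star_eq_conjTranspose]
  sum := by
    ext i j
    simp [Matrix.sum_apply, Matrix.single_apply, Matrix.one_apply, ite_and]

theorem map [Ring B] [StarRing B] {e : n → n → A} (he : IsMatrixUnits e) {F : Type*}
    [FunLike F A B] [RingHomClass F A B] [StarHomClass F A B] (φ : F) :
    IsMatrixUnits fun i j => φ (e i j) where
  mul i j k l := by rw [← map_mul, he.mul, apply_ite φ, map_zero]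
  star i j := by rw [← map_star, he.star]
  sum := by rw [← map_sum, he.sum, map_one]

theorem prod {e : m → m → A} {f : n → n → A} (he : IsMatrixUnits e) (hf : IsMatrixUnits f)
    (h : ∀ i j k l, Commute (e i j) (f k l)) :
    IsMatrixUnits fun p q : m × n => e p.1 q.1 * f p.2 q.2 where
  mul p q r s := by
    rw [(h r.1 s.1 p.2 q.2).symm.mul_mul_mul_comm, he.mul, hf.mul, ite_mul, zero_mul, mul_ite,
      mul_zero, ← ite_and]
    simp only [Prod.ext_iff]
  star p q := by rw [star_mul, he.star, hf.star, (h _ _ _ _).eq]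
  sum := by
    rw [Fintype.sum_prod_type]
    simp only [← Finset.mul_sum, hf.sum, mul_one, he.sum]

variable [Algebra ℂ A] [Ring B] [StarRing B] [Algebra ℂ B] {e : n → n → A}

/-- The ⋆-homomorphism `X ↦ ∑ π (X i j) e i j` of the matrix algebra over `B`, for a
representation `π` of `B` that commutes with the matrix units `e`. -/
noncomputable def lift (he : IsMatrixUnits e) (π : B →⋆ₐ[ℂ] A)
    (hπ : ∀ b i j, Commute (π b) (e i j)) : CStarMatrix n n B →⋆ₐ[ℂ] A where
  toFun X := ∑ i, ∑ j, π (X i j) * e i j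
  map_zero' := by simp
  map_one' := by
    simp only [CStarMatrix.one_apply, apply_ite π, map_one, map_zero, ite_mul, one_mul, zero_mul,
      Finset.sum_ite_eq, Finset.mem_univ, if_true, he.sum]
  map_add' X Y := by simp [add_mul, Finset.sum_add_distrib]
  commutes' r := by
    simp only [CStarMatrix.algebraMap_apply, apply_ite π, map_zero, ite_mul, zero_mul,
      AlgHomClass.commutes, Finset.sum_ite_eq, Finset.mem_univ, if_true, ← Finset.mul_sum, he.sum,
      mul_one]
  map_mul' X Y := by
    have hmul : ∀ i j k l, π (X i j) * e i j * (π (Y k l) * e k l) =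
        if j = k then π (X i j) * π (Y k l) * e i l else 0 := by
      intro i j k l
      rw [(hπ (Y k l) i j).symm.mul_mul_mul_comm, he.mul, mul_ite, mul_zero]
    have happly : ∀ i l, π ((X * Y) i l) = ∑ j, π (X i j) * π (Y j l) := fun i l => by
      rw [CStarMatrix.mul_apply, map_sum]
      simp only [map_mul]
    rw [Finset.sum_mul]
    refine Finset.sum_congr rfl fun i _ => ?_
    rw [Finset.sum_mul]
    simp only [happly, Finset.mul_sum, hmul, Finset.sum_mul]
    rw [Finset.sum_comm]
    refine Finset.sum_congr rfl fun j _ => ?_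
    rw [Finset.sum_comm]
    simp only [Finset.sum_ite_eq, Finset.mem_univ, if_true]
  map_star' X := by
    simp only [star_sum, star_mul, he.star, ← map_star]
    rw [Finset.sum_comm]
    refine Finset.sum_congr rfl fun i _ => Finset.sum_congr rfl fun j _ => ?_
    rw [(hπ _ _ _).eq, CStarMatrix.star_apply]

variable {he : IsMatrixUnits e} {π : B →⋆ₐ[ℂ] A} {hπ : ∀ b i j, Commute (π b) (e i j)}

theorem lift_apply (X : CStarMatrix n n B) :
    he.lift π hπ X = ∑ i, ∑ j, π (X i j) * e i j := rfl

theorem lift_diagonal (b : B) :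
    he.lift π hπ (CStarMatrix.ofMatrix (Matrix.diagonal fun _ => b)) = π b := by
  simp only [lift_apply, CStarMatrix.ofMatrix_apply, Matrix.diagonal_apply, apply_ite π, map_zero,
    ite_mul, zero_mul, Finset.sum_ite_eq, Finset.mem_univ, if_true, ← Finset.mul_sum, he.sum,
    mul_one]

theorem lift_single (p q : n) :
    he.lift π hπ (CStarMatrix.ofMatrix (Matrix.single p q 1)) = e p q := by
  simp only [lift_apply, CStarMatrix.ofMatrix_apply, Matrix.single_apply, ite_and, apply_ite π,
    map_one, map_zero, ite_mul, one_mul, zero_mul, Finset.sum_ite_irrel, Finset.sum_const_zero,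
    Finset.sum_ite_eq, Finset.mem_univ, if_true]

theorem sum_mul_lift_mul (X : CStarMatrix n n B) (i j : n) :
    ∑ k, e k i * he.lift π hπ X * e j k = π (X i j) := by
  have hmul : ∀ k p q, e k i * (π (X p q) * e p q) * e j k =
      if i = p then if q = j then π (X p q) * e k k else 0 else 0 := by
    intro k p q
    rw [← mul_assoc, ← (hπ (X p q) k i).eq, mul_assoc (π (X p q)), he.mul, mul_ite, mul_zero,
      ite_mul, zero_mul, mul_assoc, he.mul, mul_ite, mul_zero]
  simp only [lift_apply, Finset.mul_sum, Finset.sum_mul, hmul]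
  simp [← Finset.mul_sum, he.sum]

theorem lift_injective (hinj : Function.Injective π) : Function.Injective (he.lift π hπ) := by
  intro X Y hXY
  ext i j
  apply hinj
  rw [← sum_mul_lift_mul (he := he) (hπ := hπ), hXY, sum_mul_lift_mul]

end IsMatrixUnits

section IsMatrixAlgebra

/-- The ⋆-subalgebra `C` is a full matrix algebra: it is generated by a finite complete system of
matrix units of the ambient algebra. -/
def IsMatrixAlgebra {A : Type*} [Ring A] [StarRing A] [Algebra ℂ A] [StarModule ℂ A]
    (C : StarSubalgebra ℂ A) : Prop :=
  ∃ (n : Type) (_ : Fintype n) (_ : DecidableEq n) (e : n → n → A),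
    IsMatrixUnits e ∧ StarAlgebra.adjoin ℂ (Set.range e.uncurry) = C

variable {A : Type*} [Ring A] [StarRing A] [Algebra ℂ A] [StarModule ℂ A]
  {C D : StarSubalgebra ℂ A}

theorem isMatrixAlgebra_bot : IsMatrixAlgebra (⊥ : StarSubalgebra ℂ A) := by
  refine ⟨Unit, inferInstance, inferInstance, fun _ _ => 1, ⟨by simp, by simp, by simp⟩, ?_⟩
  refine le_bot_iff.mp (StarAlgebra.adjoin_le ?_)
  rintro _ ⟨_, rfl⟩
  exact one_mem _

theorem isMatrixAlgebra_of_starAlgEquiv {k : ℕ} (f : C ≃⋆ₐ[ℂ] Matrix (Fin k) (Fin k) ℂ) :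
    IsMatrixAlgebra C := by
  let e : Fin k → Fin k → A := fun i j => (f.symm (Matrix.single i j 1) : A)
  have he : IsMatrixUnits e := (IsMatrixUnits.matrix_single.map f.symm).map C.subtype
  refine ⟨Fin k, inferInstance, inferInstance, e, he, le_antisymm (StarAlgebra.adjoin_le ?_) ?_⟩
  · rintro _ ⟨p, rfl⟩
    exact (f.symm _).2
  · intro x hx
    have hx_eq : x = ∑ i, ∑ j, f ⟨x, hx⟩ i j • e i j := by
      have hsum := congrArg (C.subtype ∘ f.symm) (Matrix.matrix_eq_sum_single (f ⟨x, hx⟩))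
      simpa [e, ← map_smul, ← SetLike.val_smul] using hsum
    rw [hx_eq]
    exact sum_mem fun i _ => sum_mem fun j _ => SMulMemClass.smul_mem _
      (StarAlgebra.subset_adjoin ℂ _ ⟨(i, j), rfl⟩)

theorem IsMatrixAlgebra.sup (hC : IsMatrixAlgebra C) (hD : IsMatrixAlgebra D)
    (h : ∀ x ∈ C, ∀ y ∈ D, Commute x y) : IsMatrixAlgebra (C ⊔ D) := by
  obtain ⟨m, _, _, e, he, rfl⟩ := hC
  obtain ⟨n, _, _, f, hf, rfl⟩ := hD
  have he_mem : ∀ i j, e i j ∈ StarAlgebra.adjoin ℂ (Set.range e.uncurry) := fun i j =>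
    StarAlgebra.subset_adjoin ℂ _ ⟨(i, j), rfl⟩
  have hf_mem : ∀ i j, f i j ∈ StarAlgebra.adjoin ℂ (Set.range f.uncurry) := fun i j =>
    StarAlgebra.subset_adjoin ℂ _ ⟨(i, j), rfl⟩
  let g : m × n → m × n → A := fun p q => e p.1 q.1 * f p.2 q.2
  have hg_mem : ∀ p q, g p q ∈ StarAlgebra.adjoin ℂ (Set.range g.uncurry) := fun p q =>
    StarAlgebra.subset_adjoin ℂ _ ⟨(p, q), rfl⟩
  refine ⟨m × n, inferInstance, inferInstance, g,
    he.prod hf fun i j k l => h _ (he_mem i j) _ (hf_mem k l), le_antisymm ?_ (sup_le ?_ ?_)⟩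
  · refine StarAlgebra.adjoin_le ?_
    rintro _ ⟨⟨p, q⟩, rfl⟩
    exact mul_mem (le_sup_left (a := StarAlgebra.adjoin ℂ _) (he_mem _ _))
      (le_sup_right (b := StarAlgebra.adjoin ℂ _) (hf_mem _ _))
  · refine StarAlgebra.adjoin_le ?_
    rintro _ ⟨⟨i, j⟩, rfl⟩
    have hij : e i j = ∑ k, g (i, k) (j, k) := by simp only [g, ← Finset.mul_sum, hf.sum, mul_one]
    rw [Function.uncurry_apply_pair, hij]
    exact sum_mem fun k _ => hg_mem _ _
  · refine StarAlgebra.adjoin_le ?_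
    rintro _ ⟨⟨i, j⟩, rfl⟩
    have hij : f i j = ∑ k, g (k, i) (k, j) := by simp only [g, ← Finset.sum_mul, he.sum, one_mul]
    rw [Function.uncurry_apply_pair, hij]
    exact sum_mem fun k _ => hg_mem _ _

end IsMatrixAlgebra

theorem IsMatrixAlgebra.norm_fst_eq_norm_snd {A B : Type*} [CStarAlgebra A] [CStarAlgebra B]
    {C : StarSubalgebra ℂ A} (hC : IsMatrixAlgebra C) {ρ : B →⋆ₐ[ℂ] A} {α : B ≃⋆ₐ[ℂ] B}
    (hρ : Function.Injective ρ) (hcomm : ∀ b, ∀ x ∈ C, Commute (ρ b) x) {p : A × A}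
    (hp : p ∈ extensionGraph ρ α C) : ‖p.1‖ = ‖p.2‖ := by
  obtain ⟨n, _, _, e, he, rfl⟩ := hC
  have hcomm_e : ∀ b i j, Commute (ρ b) (e i j) := fun b i j =>
    hcomm b _ (StarAlgebra.subset_adjoin ℂ _ ⟨(i, j), rfl⟩)
  let π : CStarMatrix n n B →⋆ₐ[ℂ] A := he.lift ρ hcomm_e
  let π' : CStarMatrix n n B →⋆ₐ[ℂ] A :=
    he.lift (ρ.comp (α : B →⋆ₐ[ℂ] B)) fun b i j => hcomm_e (α b) i j
  have hle : extensionGraph ρ α (StarAlgebra.adjoin ℂ (Set.range e.uncurry)) ≤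
      (π.prod π').range := by
    refine extensionGraph_le (fun b => ?_) fun x hx => ?_
    · exact ⟨_, Prod.ext (IsMatrixUnits.lift_diagonal b) (IsMatrixUnits.lift_diagonal b)⟩
    · let diag : A →⋆ₐ[ℂ] A × A := (StarAlgHom.id ℂ A).prod (StarAlgHom.id ℂ A)
      refine (StarAlgebra.adjoin_le (S := (π.prod π').range.comap diag) ?_) hx
      rintro _ ⟨⟨i, j⟩, rfl⟩
      exact ⟨_, Prod.ext (IsMatrixUnits.lift_single i j) (IsMatrixUnits.lift_single i j)⟩
  obtain ⟨X, rfl⟩ := hle hp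
  have hπ : Function.Injective π := IsMatrixUnits.lift_injective hρ
  have hπ' : Function.Injective π' := IsMatrixUnits.lift_injective (hρ.comp α.injective)
  let _ := CStarAlgebra.spectralOrder B
  have := CStarAlgebra.spectralOrderedRing B
  exact (NonUnitalStarAlgHom.norm_map π hπ X).trans (NonUnitalStarAlgHom.norm_map π' hπ' X).symm

/-! ### Extension by the identity: quantum spins -/

section CStarAlgebra

variable {A B : Type*} [CStarAlgebra A] [CStarAlgebra B]

open scoped CStarAlgebra in
theorem isClosed_starAlgHom_equalizer (φ ψ : A →⋆ₐ[ℂ] B) :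
    IsClosed (StarAlgHom.equalizer φ ψ : Set A) :=
  isClosed_eq (map_continuous φ) (map_continuous ψ)

theorem IsProductExtension.of_extensions {AL AR : StarSubalgebra ℂ A} {αL : AL ≃⋆ₐ[ℂ] AL}
    {αR : AR ≃⋆ₐ[ℂ] AR} {S T : A ≃⋆ₐ[ℂ] A} (hS : ∀ a : AL, S a = αL a) (hS' : ∀ b ∈ AR, S b = b)
    (hT : ∀ b : AR, T b = αR b) (hT' : ∀ a ∈ AL, T a = a) :
    IsProductExtension αL αR (S.trans T) := by
  intro n a b
  simp only [map_sum, map_mul, StarAlgEquiv.trans_apply, hS, hS' _ (b _).2, hT, hT' _ (αL _).2]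

end CStarAlgebra

namespace QuantumSpinSystem

variable {Γ : Type*} [DecidableEq Γ] {A : Type*} [CStarAlgebra A] (S : QuantumSpinSystem Γ A)

theorem isMatrixAlgebra_loc (J : Finset Γ) : IsMatrixAlgebra (S.loc J) := by
  obtain ⟨k, -, ⟨f⟩⟩ := S.loc_matrix J
  exact isMatrixAlgebra_of_starAlgEquiv f

theorem loc_mono : Monotone S.loc := by
  intro I J h a ha
  obtain ⟨e, he⟩ := S.loc_tensor I (J \ I) Finset.disjoint_sdiff
  have hmem := (e (⟨a, ha⟩ ⊗ₜ 1)).2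
  rwa [he, OneMemClass.coe_one, mul_one, Finset.union_sdiff_of_subset h] at hmem

theorem commute_of_mem_loc {I J : Finset Γ} (h : Disjoint I J) {a b : A} (ha : a ∈ S.loc I)
    (hb : b ∈ S.loc J) : Commute a b := by
  obtain ⟨e, he⟩ := S.loc_tensor I J h
  have ha_eq : e (⟨a, ha⟩ ⊗ₜ 1) = a := by simp [he]
  have hb_eq : e (1 ⊗ₜ ⟨b, hb⟩) = b := by simp [he]
  rw [← ha_eq, ← hb_eq, Commute, SemiconjBy, ← MulMemClass.coe_mul, ← MulMemClass.coe_mul,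
    ← map_mul, ← map_mul]
  simp

theorem loc_union_le_sup {I J : Finset Γ} (h : Disjoint I J) :
    S.loc (I ∪ J) ≤ S.loc I ⊔ S.loc J := by
  intro a ha
  obtain ⟨e, he⟩ := S.loc_tensor I J h
  obtain ⟨t, ht⟩ := e.surjective ⟨a, ha⟩
  obtain rfl : (e t : A) = a := congrArg Subtype.val ht
  clear ht ha
  induction t with
  | zero => simp
  | tmul a b =>
    rw [he]
    exact mul_mem (le_sup_left (a := S.loc I) a.2) (le_sup_right (b := S.loc J) b.2)
  | add x y hx hy =>
    rw [map_add]
    exact add_mem hx hy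

variable {I K : Set Γ} {J : Finset Γ}

instance isClosed_region : IsClosed (S.region I : Set A) :=
  StarSubalgebra.isClosed_topologicalClosure _

theorem loc_le_region (h : (J : Set Γ) ⊆ I) : S.loc J ≤ S.region I :=
  (le_iSup (fun J : {J : Finset Γ // (J : Set Γ) ⊆ I} => S.loc J) ⟨J, h⟩).trans
    (StarSubalgebra.le_topologicalClosure _)

theorem region_le {T : StarSubalgebra ℂ A} (hT : IsClosed (T : Set A))
    (h : ∀ J : Finset Γ, (J : Set Γ) ⊆ I → S.loc J ≤ T) : S.region I ≤ T :=
  StarSubalgebra.topologicalClosure_minimal (iSup_le fun J => h J.1 J.2) hT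

theorem region_mono (h : I ⊆ K) : S.region I ≤ S.region K :=
  S.region_le S.isClosed_region fun _ hJ => S.loc_le_region (hJ.trans h)

theorem commute_of_mem_region_of_mem_loc (h : Disjoint I J) {a b : A} (ha : a ∈ S.region I)
    (hb : b ∈ S.loc J) : Commute a b := by
  have hle : S.region I ≤ StarSubalgebra.centralizer ℂ (S.loc J : Set A) := by
    refine S.region_le (isClosed_starSubalgebra_centralizer _) fun K hK x hx => ?_
    have hKJ : Disjoint K J := Finset.disjoint_coe.mp (h.mono_left hK)
    exact (StarSubalgebra.mem_centralizer_iff ℂ).mpr fun y hy =>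
      ⟨(S.commute_of_mem_loc hKJ hx hy).symm.eq,
        (S.commute_of_mem_loc hKJ hx (star_mem hy)).symm.eq⟩
  exact ((StarSubalgebra.mem_centralizer_iff ℂ).mp (hle ha) b hb).1.symm

variable (I) in
theorem dense_iSup_region_sup_loc :
    Dense ((⨆ J : {J : Finset Γ // (J : Set Γ) ⊆ Iᶜ}, S.region I ⊔ S.loc J :
      StarSubalgebra ℂ A) : Set A) := by
  classical
  refine S.dense_loc.mono (Set.iUnion_subset fun J => ?_)
  have hin : (J.filter (· ∈ I) : Set Γ) ⊆ I := fun x hx => (Finset.mem_filter.mp hx).2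
  have hout : (J.filter (· ∉ I) : Set Γ) ⊆ Iᶜ := fun x hx => (Finset.mem_filter.mp hx).2
  change S.loc J ≤ _
  calc S.loc J = S.loc (J.filter (· ∈ I) ∪ J.filter (· ∉ I)) := by
        rw [Finset.filter_union_filter_not_eq]
    _ ≤ S.loc (J.filter (· ∈ I)) ⊔ S.loc (J.filter (· ∉ I)) :=
        S.loc_union_le_sup (Finset.disjoint_filter_filter_not _ _ _)
    _ ≤ S.region I ⊔ S.loc (J.filter (· ∉ I)) := sup_le_sup_right (S.loc_le_region hin) _
    _ ≤ _ := le_iSup (fun J : {J : Finset Γ // (J : Set Γ) ⊆ Iᶜ} => S.region I ⊔ S.loc J)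
        ⟨_, hout⟩

theorem exists_extension (α : S.region I ≃⋆ₐ[ℂ] S.region I) :
    ∃ T : A ≃⋆ₐ[ℂ] A, (∀ a : S.region I, T a = α a) ∧ ∀ b ∈ S.region Iᶜ, T b = b := by
  let ι := {J : Finset Γ // (J : Set Γ) ⊆ Iᶜ}
  have : Nonempty ι := ⟨⟨∅, by simp⟩⟩
  have hdir : Directed (· ≤ ·) fun J : ι => S.loc J := fun J K =>
    ⟨⟨J ∪ K, by simpa using ⟨J.2, K.2⟩⟩, S.loc_mono Finset.subset_union_left,
      S.loc_mono Finset.subset_union_right⟩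
  obtain ⟨T, hTα, hTloc⟩ := exists_extension_of_norm_eq (α := α) hdir
    ((range_starSubalgebra_subtype (S.region I)).symm ▸ S.dense_iSup_region_sup_loc I)
    fun J _ hp => (S.isMatrixAlgebra_loc J).norm_fst_eq_norm_snd Subtype.val_injective
      (fun b _ hx => S.commute_of_mem_region_of_mem_loc
        (Set.disjoint_left.mpr fun _ hi hi' => J.2 hi' hi) b.2 hx) hp
  refine ⟨T, hTα, S.region_le (T := StarAlgHom.equalizer (T : A →⋆ₐ[ℂ] A) (.id ℂ A))
    (isClosed_starAlgHom_equalizer _ _) fun J hJ b hb => hTloc ⟨J, hJ⟩ b hb⟩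

end QuantumSpinSystem

/-! ### The Klein transform -/

section KleinTwist

variable {R A B : Type*} [CommSemiring R] [Ring A] [StarRing A] [Algebra R A]
  [Ring B] [StarRing B] [Algebra R B]

/-- The Klein transform `b ↦ ρ b * q + ρ (γ b) * (1 - q)` of the representation `ρ`: it is twisted
by `γ` off the range of the projection `q`. If `γ` is a grading and `P = 2 q - 1`, then an even `b`
is sent to `ρ b` and an odd one to `ρ b * P`. -/
def kleinTwist (ρ : B →⋆ₐ[R] A) (γ : B →⋆ₐ[R] B) {q : A} (hq : IsStarProjection q)
    (hρ : ∀ b, Commute q (ρ b)) : B →⋆ₐ[R] A where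
  toFun b := ρ b * q + ρ (γ b) * (1 - q)
  map_zero' := by simp
  map_one' := by simp
  map_add' x y := by
    simp only [map_add, add_mul]
    abel
  map_mul' x y := by
    have hρ' : ∀ b, Commute (1 - q) (ρ b) := fun b => (Commute.one_left _).sub_left (hρ b)
    simp only [map_mul, add_mul, mul_add, (hρ _).mul_mul_mul_comm, (hρ' _).mul_mul_mul_comm,
      hq.isIdempotentElem.eq, hq.one_sub.isIdempotentElem.eq, hq.isIdempotentElem.mul_one_sub_self,
      hq.isIdempotentElem.one_sub_mul_self, mul_zero, zero_add, add_zero]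
  commutes' r := by simp only [AlgHomClass.commutes, ← mul_add, add_sub_cancel, mul_one]
  map_star' x := by
    have hρ' : Commute (1 - q) (ρ (γ (star x))) := (Commute.one_left _).sub_left (hρ _)
    simp only [star_add, star_mul, hq.isSelfAdjoint.star_eq, hq.one_sub.isSelfAdjoint.star_eq,
      ← map_star, (hρ _).eq, hρ'.eq]

variable {ρ : B →⋆ₐ[R] A} {γ : B →⋆ₐ[R] B} {q : A} {hq : IsStarProjection q}
  {hρ : ∀ b, Commute q (ρ b)}

theorem kleinTwist_apply (b : B) : kleinTwist ρ γ hq hρ b = ρ b * q + ρ (γ b) * (1 - q) := rfl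

theorem kleinTwist_mul (b : B) : kleinTwist ρ γ hq hρ b * q = ρ b * q := by
  rw [kleinTwist_apply, add_mul, mul_assoc, mul_assoc, hq.isIdempotentElem.eq,
    hq.isIdempotentElem.one_sub_mul_self, mul_zero, add_zero]

theorem kleinTwist_mul_one_sub (b : B) :
    kleinTwist ρ γ hq hρ b * (1 - q) = ρ (γ b) * (1 - q) := by
  rw [kleinTwist_apply, add_mul, mul_assoc, mul_assoc, hq.one_sub.isIdempotentElem.eq,
    hq.isIdempotentElem.mul_one_sub_self, mul_zero, zero_add]

theorem kleinTwist_injective (hinj : Function.Injective ρ) (hγ : Function.Involutive γ)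
    {Θ : A →⋆ₐ[R] A} (hΘρ : ∀ b, Θ (ρ b) = ρ (γ b)) (hΘq : Θ q = q) :
    Function.Injective (kleinTwist ρ γ hq hρ) := by
  refine (injective_iff_map_eq_zero _).mpr fun b hb => ?_
  have hb_mul : ρ b * q = 0 := by
    rw [← kleinTwist_mul (hq := hq) (hρ := hρ) (γ := γ), hb, zero_mul]
  have hb_mul_one_sub : ρ b * (1 - q) = 0 :=
    calc ρ b * (1 - q) = Θ (ρ (γ b) * (1 - q)) := by
          rw [map_mul, hΘρ, hγ, map_sub, map_one, hΘq]
      _ = 0 := by rw [← kleinTwist_mul_one_sub (hq := hq) (hρ := hρ), hb, zero_mul, map_zero]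
  refine (map_eq_zero_iff ρ hinj).mp ?_
  rw [← mul_one (ρ b), ← add_sub_cancel q 1, mul_add, hb_mul, hb_mul_one_sub, add_zero]

theorem kleinTwist_mul_add_kleinTwist_mul (hγ : Function.Involutive γ) (b : B) :
    kleinTwist ρ γ hq hρ b * q + kleinTwist ρ γ hq hρ (γ b) * (1 - q) = ρ b := by
  rw [kleinTwist_mul, kleinTwist_mul_one_sub, hγ, ← mul_add, add_sub_cancel, mul_one]

end KleinTwist

theorem kleinTwist_eq_mul {A B : Type*} [Ring A] [StarRing A] [Algebra ℂ A] [Ring B] [StarRing B]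
    [Algebra ℂ B] {ρ : B →⋆ₐ[ℂ] A} {γ : B →⋆ₐ[ℂ] B} {P : A}
    {hq : IsStarProjection ((1 / 2 : ℂ) • (1 + P))}
    {hρ : ∀ b, Commute ((1 / 2 : ℂ) • (1 + P)) (ρ b)} {b : B} (hb : γ b = -b) :
    kleinTwist ρ γ hq hρ b = ρ b * P := by
  simp only [kleinTwist_apply, hb, map_neg, mul_sub, mul_smul_comm, mul_add, neg_mul, mul_one]
  module

theorem extensionGraph_le_extensionGraph_kleinTwist {A B : Type*} [CStarAlgebra A] [Ring B]
    [StarRing B] [Algebra ℂ B] {ρ : B →⋆ₐ[ℂ] A} {γ : B →⋆ₐ[ℂ] B} {q : A} {hq : IsStarProjection q}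
    {hρ : ∀ b, Commute q (ρ b)} (hγ : Function.Involutive γ) {α : B ≃⋆ₐ[ℂ] B}
    (hα : ∀ b, α (γ b) = γ (α b)) {C : StarSubalgebra ℂ A} (hqC : q ∈ C) :
    extensionGraph ρ α C ≤ extensionGraph (kleinTwist ρ γ hq hρ) α C := by
  refine extensionGraph_le (fun b => ?_) fun x hx => diag_mem_extensionGraph hx
  have hmem := add_mem
    (mul_mem (apply_mem_extensionGraph (ρ := kleinTwist ρ γ hq hρ) (α := α) b)
      (diag_mem_extensionGraph hqC))
    (mul_mem (apply_mem_extensionGraph (ρ := kleinTwist ρ γ hq hρ) (α := α) (γ b))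
      (diag_mem_extensionGraph (sub_mem (one_mem C) hqC)))
  simpa only [Prod.mk_mul_mk, Prod.mk_add_mk, hα, kleinTwist_mul_add_kleinTwist_mul hγ] using hmem

/-! ### Fermion parity and the Jordan–Wigner transformation -/

/-- The `2 × 2` matrix units built from an annihilation operator `d`, with `false` labelling the
vacuum and `true` the occupied state. -/
def fermionUnits {A : Type*} [Mul A] [Star A] (d : A) : Bool → Bool → A
  | false, false => d * star d
  | false, true => d
  | true, false => star d
  | true, true => star d * d

section FermionUnits

variable {A : Type*} [Ring A] [StarRing A] {d : A}

theorem mul_star_mul_self_of_anticomm (hd : d * d = 0) (hd' : d * star d + star d * d = 1) :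
    d * star d * d = d := by
  simpa [add_mul, mul_assoc, hd] using congrArg (· * d) hd'

theorem isMatrixUnits_fermionUnits (hd : d * d = 0) (hd' : d * star d + star d * d = 1) :
    IsMatrixUnits (fermionUnits d) where
  mul i j k l := by
    have hs : star d * star d = 0 := by rw [← star_mul, hd, star_zero]
    have hdsd : d * (star d * d) = d := by
      rw [← mul_assoc, mul_star_mul_self_of_anticomm hd hd']
    have hsds : star d * (d * star d) = star d := by simpa [mul_assoc] using congrArg star hdsd
    have hdd : ∀ x, d * (d * x) = 0 := fun x => by rw [← mul_assoc, hd, zero_mul]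
    have hss : ∀ x, star d * (star d * x) = 0 := fun x => by rw [← mul_assoc, hs, zero_mul]
    cases i <;> cases j <;> cases k <;> cases l <;>
      simp [fermionUnits, mul_assoc, hd, hs, hdsd, hsds, hdd, hss]
  star i j := by cases i <;> cases j <;> simp [fermionUnits]
  sum := by simpa [fermionUnits, add_comm] using hd'

theorem isMatrixAlgebra_adjoin_singleton [Algebra ℂ A] [StarModule ℂ A] (hd : d * d = 0)
    (hd' : d * star d + star d * d = 1) : IsMatrixAlgebra (StarAlgebra.adjoin ℂ {d}) := by
  refine ⟨Bool, inferInstance, inferInstance, fermionUnits d, isMatrixUnits_fermionUnits hd hd',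
    le_antisymm (StarAlgebra.adjoin_le ?_) (StarAlgebra.adjoin_mono ?_)⟩
  · have hmem := StarAlgebra.self_mem_adjoin_singleton ℂ d
    rintro _ ⟨⟨_ | _, _ | _⟩, rfl⟩
    exacts [mul_mem hmem (star_mem hmem), hmem, star_mem hmem, mul_mem (star_mem hmem) hmem]
  · exact Set.singleton_subset_iff.mpr ⟨(false, true), rfl⟩

end FermionUnits

section FermionRegion

variable {Γ A : Type*} [CStarAlgebra A] {c : Γ → A} {I K : Set Γ}

instance isClosed_fermionRegion : IsClosed (fermionRegion c I : Set A) :=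
  StarSubalgebra.isClosed_topologicalClosure _

theorem fermionRegion_le {T : StarSubalgebra ℂ A} (hT : IsClosed (T : Set A))
    (h : ∀ i ∈ I, c i ∈ T) : fermionRegion c I ≤ T :=
  StarSubalgebra.topologicalClosure_minimal
    (StarAlgebra.adjoin_le (Set.image_subset_iff.mpr h)) hT

theorem fermionRegion_mono (h : I ⊆ K) : fermionRegion c I ≤ fermionRegion c K :=
  fermionRegion_le isClosed_fermionRegion fun _ hi => mem_fermionRegion c (h hi)

theorem eq_top_of_generators_mem {T : StarSubalgebra ℂ (fermionRegion c I)}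
    (hT : IsClosed (T : Set (fermionRegion c I)))
    (h : ∀ i (hi : i ∈ I), ⟨c i, mem_fermionRegion c hi⟩ ∈ T) : T = ⊤ := by
  have hle : fermionRegion c I ≤ T.map (fermionRegion c I).subtype :=
    fermionRegion_le (isClosed_fermionRegion.isClosedEmbedding_subtypeVal.isClosedMap _ hT)
      fun i hi => ⟨_, h i hi, rfl⟩
  refine eq_top_iff.mpr fun a _ => ?_
  obtain ⟨b, hb, hba⟩ := hle a.2
  exact Subtype.ext hba ▸ hb

theorem fermionRegion_hom_ext {B : Type*} [CStarAlgebra B] {φ ψ : fermionRegion c I →⋆ₐ[ℂ] B}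
    (h : ∀ i (hi : i ∈ I), φ ⟨c i, mem_fermionRegion c hi⟩ = ψ ⟨c i, mem_fermionRegion c hi⟩) :
    φ = ψ := by
  have htop := eq_top_of_generators_mem (isClosed_starAlgHom_equalizer φ ψ) h
  ext a
  have ha : a ∈ StarAlgHom.equalizer φ ψ := htop ▸ StarSubalgebra.mem_top
  exact ha

end FermionRegion

namespace IsFermionSystem

variable {Γ : Type*} [DecidableEq Γ] {A : Type*} [CStarAlgebra A] {c : Γ → A}

theorem mul_self (h : IsFermionSystem c) (j : Γ) : c j * c j = 0 := by
  have hjj := h.anticomm j j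
  rw [← two_smul ℂ (c j * c j)] at hjj
  exact (smul_eq_zero.mp hjj).resolve_left two_ne_zero

theorem mul_star_add (h : IsFermionSystem c) (j : Γ) :
    c j * star (c j) + star (c j) * c j = 1 := by
  rw [add_comm, h.star_anticomm, if_pos rfl]

theorem semiconjBy (h : IsFermionSystem c) (i j : Γ) : SemiconjBy (c i) (c j) (-c j) := by
  rw [SemiconjBy, neg_mul]
  exact eq_neg_of_add_eq_zero_left (h.anticomm i j)

theorem star_semiconjBy (h : IsFermionSystem c) {i j : Γ} (hij : i ≠ j) :
    SemiconjBy (star (c i)) (c j) (-c j) := by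
  rw [SemiconjBy, neg_mul]
  exact eq_neg_of_add_eq_zero_left ((h.star_anticomm i j).trans (if_neg hij))

theorem coe_grading (h : IsFermionSystem c) {I : Set Γ} {Θ : A →⋆ₐ[ℂ] A}
    (hΘ : ∀ i, Θ (c i) = -c i) (a : fermionRegion c I) : (h.grading I a : A) = Θ a := by
  have heq : (fermionRegion c I).subtype.comp (h.grading I : _ →⋆ₐ[ℂ] fermionRegion c I) =
      Θ.comp (fermionRegion c I).subtype := by
    refine fermionRegion_hom_ext fun i hi => ?_
    change (h.grading I ⟨c i, mem_fermionRegion c hi⟩ : A) = Θ (c i)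
    rw [h.grading_apply I hi, hΘ, NegMemClass.coe_neg]
  exact DFunLike.congr_fun heq a

theorem grading_involutive (h : IsFermionSystem c) (I : Set Γ) :
    Function.Involutive (h.grading I) := by
  let γ : fermionRegion c I →⋆ₐ[ℂ] fermionRegion c I := h.grading I
  have heq : γ.comp γ = StarAlgHom.id ℂ _ := by
    refine fermionRegion_hom_ext fun i hi => ?_
    change h.grading I (h.grading I ⟨c i, mem_fermionRegion c hi⟩) = ⟨c i, mem_fermionRegion c hi⟩
    rw [h.grading_apply I hi, map_neg, h.grading_apply I hi, neg_neg]
  exact DFunLike.congr_fun heq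

end IsFermionSystem

/-- `P` is the fermion parity `(-1)^N` of the region `J`, up to sign: a symmetry in the algebra
generated by `c j`, `j ∈ J`, that anticommutes with these and commutes with the other `c i`. -/
structure IsParity {Γ A : Type*} [Ring A] [StarRing A] [Algebra ℂ A] [StarModule ℂ A] (c : Γ → A)
    (J : Set Γ) (P : A) : Prop where
  isSelfAdjoint : IsSelfAdjoint P
  mul_self : P * P = 1
  mem_adjoin : P ∈ StarAlgebra.adjoin ℂ (c '' J)
  semiconjBy : ∀ j ∈ J, SemiconjBy P (c j) (-c j)
  commute : ∀ i ∉ J, Commute P (c i)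

theorem isParity_empty {Γ A : Type*} [Ring A] [StarRing A] [Algebra ℂ A] [StarModule ℂ A]
    (c : Γ → A) : IsParity c ∅ 1 where
  isSelfAdjoint := .one A
  mul_self := mul_one 1
  mem_adjoin := one_mem _
  semiconjBy _ hj := hj.elim
  commute _ _ := .one_left _

namespace IsParity

variable {Γ A : Type*} [CStarAlgebra A] {c : Γ → A} {I J : Set Γ} {P Q : A}

theorem commute_of_mem_fermionRegion (hP : IsParity c J P) (hJI : Disjoint J I) {x : A}
    (hx : x ∈ fermionRegion c I) : Commute P x := by
  have hle : fermionRegion c I ≤ StarSubalgebra.centralizer ℂ {P} :=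
    fermionRegion_le (isClosed_starSubalgebra_centralizer _) fun i hi =>
      (StarSubalgebra.mem_centralizer_iff ℂ).mpr <| by
        rintro _ rfl
        rw [hP.isSelfAdjoint.star_eq, and_self]
        exact (hP.commute i (Set.disjoint_right.mp hJI hi)).eq
  exact ((StarSubalgebra.mem_centralizer_iff ℂ).mp (hle hx) P rfl).1

theorem union (hP : IsParity c J P) (hQ : IsParity c I Q) (hJI : Disjoint J I) :
    IsParity c (J ∪ I) (P * Q) := by
  have hPQ : Commute P Q :=
    hP.commute_of_mem_fermionRegion hJI (StarSubalgebra.le_topologicalClosure _ hQ.mem_adjoin)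
  refine ⟨(hP.isSelfAdjoint.commute_iff hQ.isSelfAdjoint).mp hPQ, ?_, ?_, ?_, fun i hi => ?_⟩
  · rw [hPQ.symm.mul_mul_mul_comm, hP.mul_self, hQ.mul_self, mul_one]
  · exact mul_mem (StarAlgebra.adjoin_mono (Set.image_mono Set.subset_union_left) hP.mem_adjoin)
      (StarAlgebra.adjoin_mono (Set.image_mono Set.subset_union_right) hQ.mem_adjoin)
  · rintro j (hj | hj)
    · exact (hP.semiconjBy j hj).mul_left (hQ.commute j (Set.disjoint_left.mp hJI hj))
    · exact SemiconjBy.mul_left (hP.commute j (Set.disjoint_right.mp hJI hj)).neg_right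
        (hQ.semiconjBy j hj)
  · exact (hP.commute i (hi <| .inl ·)).mul_left (hQ.commute i (hi <| .inr ·))

theorem map_eq (hP : IsParity c J P) {Θ : A →⋆ₐ[ℂ] A} (hΘ : ∀ i, Θ (c i) = -c i) : Θ P = P := by
  have hPu : P ∈ unitary A := by
    rw [Unitary.mem_iff, hP.isSelfAdjoint.star_eq, and_self, hP.mul_self]
  let σ : A ≃⋆ₐ[ℂ] A := Unitary.conjStarAlgAut ℂ A ⟨P, hPu⟩
  have hσ : ∀ x, σ x = P * x * P := fun x => by
    change P * x * star P = P * x * P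
    rw [hP.isSelfAdjoint.star_eq]
  have hle : StarAlgebra.adjoin ℂ (c '' J) ≤ StarAlgHom.equalizer Θ (σ : A →⋆ₐ[ℂ] A) := by
    refine StarAlgebra.adjoin_le ?_
    rintro _ ⟨j, hj, rfl⟩
    change Θ (c j) = σ (c j)
    rw [hΘ, hσ, (hP.semiconjBy j hj).eq, mul_assoc, hP.mul_self, mul_one]
  calc Θ P = σ P := hle hP.mem_adjoin
    _ = P := by rw [hσ, hP.mul_self, one_mul]

theorem isStarProjection (hP : IsParity c J P) : IsStarProjection ((1 / 2 : ℂ) • (1 + P)) where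
  isIdempotentElem := by
    rw [IsIdempotentElem, smul_mul_smul_comm, mul_add, add_mul, add_mul, hP.mul_self,
      one_mul, one_mul, mul_one]
    module
  isSelfAdjoint := by
    rw [IsSelfAdjoint, star_smul, star_add, star_one, hP.isSelfAdjoint.star_eq]
    simp

theorem adjoin_image_insert (hP : IsParity c J P) (i : Γ) :
    StarAlgebra.adjoin ℂ (c '' insert i J) =
      StarAlgebra.adjoin ℂ (c '' J) ⊔ StarAlgebra.adjoin ℂ {P * c i} := by
  have hP_mem := hP.mem_adjoin
  have hJ : StarAlgebra.adjoin ℂ (c '' J) ≤ StarAlgebra.adjoin ℂ (c '' insert i J) :=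
    StarAlgebra.adjoin_mono (Set.image_mono (Set.subset_insert i J))
  refine le_antisymm (StarAlgebra.adjoin_le ?_)
    (sup_le hJ (StarAlgebra.adjoin_le (Set.singleton_subset_iff.mpr ?_)))
  · rintro _ ⟨j, rfl | hj, rfl⟩
    · have hmem := mul_mem (le_sup_left (b := StarAlgebra.adjoin ℂ {P * c j}) hP_mem)
        (le_sup_right (a := StarAlgebra.adjoin ℂ (c '' J))
          (StarAlgebra.self_mem_adjoin_singleton ℂ (P * c j)))
      rwa [← mul_assoc, hP.mul_self, one_mul] at hmem
    · exact le_sup_left (a := StarAlgebra.adjoin ℂ (c '' J))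
        (StarAlgebra.subset_adjoin ℂ _ ⟨j, hj, rfl⟩)
  · exact mul_mem (hJ hP_mem)
      (StarAlgebra.subset_adjoin ℂ _ ⟨i, Set.mem_insert i J, rfl⟩)

end IsParity

namespace IsFermionSystem

variable {Γ : Type*} [DecidableEq Γ] {A : Type*} [CStarAlgebra A] {c : Γ → A}

theorem isParity_singleton (h : IsFermionSystem c) (j : Γ) :
    IsParity c {j} (2 * (c j * star (c j)) - 1) := by
  have hccc : c j * star (c j) * c j = c j :=
    mul_star_mul_self_of_anticomm (h.mul_self j) (h.mul_star_add j)
  have hproj : IsStarProjection (c j * star (c j)) :=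
    ⟨by rw [IsIdempotentElem, ← mul_assoc, hccc], .mul_star_self (c j)⟩
  refine ⟨?_, ?_, ?_, ?_, fun i hi => ?_⟩
  · rw [two_mul]
    exact (hproj.isSelfAdjoint.add hproj.isSelfAdjoint).sub (.one A)
  · have hidem := hproj.isIdempotentElem.eq
    calc (2 * (c j * star (c j)) - 1) * (2 * (c j * star (c j)) - 1)
        = 4 * (c j * star (c j) * (c j * star (c j)) - c j * star (c j)) + 1 := by noncomm_ring
      _ = 1 := by rw [hidem, sub_self, mul_zero, zero_add]
  · have hmem : c j ∈ StarAlgebra.adjoin ℂ (c '' {j}) :=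
      StarAlgebra.subset_adjoin ℂ _ ⟨j, rfl, rfl⟩
    rw [two_mul]
    have hmem' := mul_mem hmem (star_mem hmem)
    exact sub_mem (add_mem hmem' hmem') (one_mem _)
  · rintro _ rfl
    rw [SemiconjBy, sub_mul, mul_assoc 2, hccc, mul_sub, neg_mul, two_mul (_ * _), mul_add,
      ← mul_assoc, h.mul_self]
    noncomm_ring
  · have hcomm : Commute (c j * star (c j)) (c i) := by
      have hstar := h.star_semiconjBy (Ne.symm hi)
      have hmul := (h.semiconjBy j i).neg_right.mul_left hstar
      rwa [neg_neg] at hmul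
    exact ((Nat.cast_commute 2 (c i)).mul_left hcomm).sub_left (.one_left _)

theorem exists_isParity (h : IsFermionSystem c) (J : Finset Γ) : ∃ P, IsParity c J P := by
  induction J using Finset.induction_on with
  | empty => exact ⟨1, by simpa using isParity_empty c⟩
  | insert j J hj ih =>
    obtain ⟨P, hP⟩ := ih
    rw [Finset.coe_insert, Set.insert_eq]
    exact ⟨_, (h.isParity_singleton j).union hP (Set.disjoint_singleton_left.mpr hj)⟩

section Parity

variable {I J : Set Γ} {P : A}

theorem commute_of_mem_adjoin_parity_mul (h : IsFermionSystem c) (hP : IsParity c J P) {i : Γ}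
    (hi : i ∉ J) {x y : A} (hx : x ∈ StarAlgebra.adjoin ℂ (c '' J))
    (hy : y ∈ StarAlgebra.adjoin ℂ {P * c i}) : Commute x y := by
  refine commute_of_mem_adjoin_of_mem_adjoin ?_ hx hy
  rintro _ ⟨j, hj, rfl⟩ _ rfl
  have hij : i ≠ j := fun hij => hi (hij ▸ hj)
  have hPj := hP.semiconjBy j hj
  have hPj' : SemiconjBy P (-c j) (c j) := by simpa using hPj.neg_right
  have hij' : SemiconjBy (star (c i)) (-c j) (c j) := by
    simpa using (h.star_semiconjBy hij).neg_right
  rw [star_mul, hP.isSelfAdjoint.star_eq]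
  exact ⟨Commute.symm (hPj'.mul_left (h.semiconjBy i j)), Commute.symm (hij'.mul_left hPj)⟩

theorem isMatrixAlgebra_adjoin_parity_mul (h : IsFermionSystem c) (hP : IsParity c J P) {i : Γ}
    (hi : i ∉ J) : IsMatrixAlgebra (StarAlgebra.adjoin ℂ {P * c i}) := by
  have hcomm := hP.commute i hi
  have hcomm' : Commute P (star (c i)) := by
    simpa only [hP.isSelfAdjoint.star_eq] using hcomm.star_star
  refine isMatrixAlgebra_adjoin_singleton ?_ ?_
  · rw [hcomm.symm.mul_mul_mul_comm, h.mul_self, mul_zero]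
  · rw [star_mul, hP.isSelfAdjoint.star_eq, ← hcomm'.eq, hcomm.symm.mul_mul_mul_comm,
      hcomm'.symm.mul_mul_mul_comm, hP.mul_self, one_mul, one_mul, h.mul_star_add]

/-- The Jordan–Wigner transformation: replacing `c i` by `P * c i`, with `P` the parity of `J`,
splits off a commuting `2 × 2` matrix algebra. -/
theorem isMatrixAlgebra_adjoin (h : IsFermionSystem c) (J : Finset Γ) :
    IsMatrixAlgebra (StarAlgebra.adjoin ℂ (c '' (J : Set Γ))) := by
  induction J using Finset.induction_on with
  | empty =>
    rw [Finset.coe_empty, Set.image_empty, ← Set.bot_eq_empty, StarAlgebra.gc.l_bot]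
    exact isMatrixAlgebra_bot
  | insert i J hi ih =>
    obtain ⟨P, hP⟩ := h.exists_isParity J
    rw [Finset.coe_insert, hP.adjoin_image_insert i]
    exact ih.sup (h.isMatrixAlgebra_adjoin_parity_mul hP hi) fun _ hx _ hy =>
      h.commute_of_mem_adjoin_parity_mul hP hi hx hy

end Parity

end IsFermionSystem

/-! ### Extension by the identity: fermions -/

namespace IsFermionSystem

variable {Γ : Type*} [DecidableEq Γ] {A : Type*} [CStarAlgebra A] {c : Γ → A}

section Extension

variable {I J : Set Γ} {P : A}

open scoped CStarAlgebra in
theorem commute_kleinTwist_grading (h : IsFermionSystem c) (hP : IsParity c J P)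
    (hIJ : Disjoint I J) {hq : IsStarProjection ((1 / 2 : ℂ) • (1 + P))}
    {hρ : ∀ a, Commute ((1 / 2 : ℂ) • (1 + P)) ((fermionRegion c I).subtype a)}
    (a : fermionRegion c I) {x : A} (hx : x ∈ StarAlgebra.adjoin ℂ (c '' J)) :
    Commute (kleinTwist (fermionRegion c I).subtype (h.grading I : _ →⋆ₐ[ℂ] fermionRegion c I)
      hq hρ a) x := by
  let κ := kleinTwist (fermionRegion c I).subtype
    (h.grading I : _ →⋆ₐ[ℂ] fermionRegion c I) hq hρ
  let Z := StarSubalgebra.centralizer ℂ (StarAlgebra.adjoin ℂ (c '' J) : Set A)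
  have htop : Z.comap κ = ⊤ := by
    refine eq_top_of_generators_mem
      ((isClosed_starSubalgebra_centralizer (R := ℂ) _).preimage (map_continuous κ)) fun i hi => ?_
    have hiJ : i ∉ J := Set.disjoint_left.mp hIJ hi
    have hκ : κ ⟨c i, mem_fermionRegion c hi⟩ = P * c i :=
      (kleinTwist_eq_mul (h.grading_apply I hi)).trans (hP.commute i hiJ).symm.eq
    change κ _ ∈ Z
    rw [hκ]
    have hself := StarAlgebra.self_mem_adjoin_singleton ℂ (P * c i)
    exact (StarSubalgebra.mem_centralizer_iff ℂ).mpr fun y hy =>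
      ⟨(h.commute_of_mem_adjoin_parity_mul hP hiJ hy hself).eq,
        (h.commute_of_mem_adjoin_parity_mul hP hiJ (star_mem hy) hself).eq⟩
  have ha : a ∈ Z.comap κ := htop ▸ StarSubalgebra.mem_top
  exact ((StarSubalgebra.mem_centralizer_iff ℂ).mp ha x hx).1.symm

theorem norm_fst_eq_norm_snd (h : IsFermionSystem c)
    {α : fermionRegion c I ≃⋆ₐ[ℂ] fermionRegion c I}
    (hα : ∀ a, α (h.grading I a) = h.grading I (α a)) {J : Finset Γ} (hIJ : Disjoint I J)
    {p : A × A} (hp : p ∈ extensionGraph (fermionRegion c I).subtype α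
      (StarAlgebra.adjoin ℂ (c '' (J : Set Γ)))) : ‖p.1‖ = ‖p.2‖ := by
  obtain ⟨P, hP⟩ := h.exists_isParity J
  obtain ⟨Θ, hΘ⟩ := h.exists_starAlgHom
  let γ : fermionRegion c I →⋆ₐ[ℂ] fermionRegion c I := h.grading I
  have hγ : Function.Involutive γ := h.grading_involutive I
  let q : A := (1 / 2 : ℂ) • (1 + P)
  have hq : IsStarProjection q := hP.isStarProjection
  have hρ : ∀ a, Commute q ((fermionRegion c I).subtype a) := fun a =>
    ((Commute.one_left _).add_left
      (hP.commute_of_mem_fermionRegion hIJ.symm a.2)).smul_left _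
  have hqC : q ∈ StarAlgebra.adjoin ℂ (c '' (J : Set Γ)) :=
    SMulMemClass.smul_mem _ (add_mem (one_mem _) hP.mem_adjoin)
  have hΘq : Θ q = q := by rw [map_smul, map_add, map_one, hP.map_eq hΘ]
  exact (h.isMatrixAlgebra_adjoin J).norm_fst_eq_norm_snd
    (kleinTwist_injective (hq := hq) (hρ := hρ) Subtype.val_injective hγ
      (fun a => (h.coe_grading hΘ a).symm) hΘq)
    (fun a _ hx => h.commute_kleinTwist_grading hP hIJ a hx)
    (extensionGraph_le_extensionGraph_kleinTwist hγ hα hqC hp)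

variable (I) in
theorem dense_iSup_fermionRegion_sup_adjoin (h : IsFermionSystem c) :
    Dense ((⨆ J : {J : Finset Γ // (J : Set Γ) ⊆ Iᶜ},
      fermionRegion c I ⊔ StarAlgebra.adjoin ℂ (c '' (J : Set Γ)) : StarSubalgebra ℂ A) :
        Set A) := by
  refine h.dense_adjoin.mono (StarAlgebra.adjoin_le ?_)
  rintro _ ⟨i, rfl⟩
  have hle := le_iSup fun J : {J : Finset Γ // (J : Set Γ) ⊆ Iᶜ} =>
    fermionRegion c I ⊔ StarAlgebra.adjoin ℂ (c '' (J : Set Γ))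
  by_cases hi : i ∈ I
  · exact hle ⟨∅, by simp⟩ (le_sup_left (a := fermionRegion c I) (mem_fermionRegion c hi))
  · exact hle ⟨{i}, by simpa using hi⟩ (le_sup_right (a := fermionRegion c I)
      (StarAlgebra.subset_adjoin ℂ _ ⟨i, by simp, rfl⟩))

theorem exists_extension (h : IsFermionSystem c)
    (α : fermionRegion c I ≃⋆ₐ[ℂ] fermionRegion c I)
    (hα : ∀ a, α (h.grading I a) = h.grading I (α a)) :
    ∃ T : A ≃⋆ₐ[ℂ] A, (∀ a : fermionRegion c I, T a = α a) ∧
      ∀ b ∈ fermionRegion c Iᶜ, T b = b := by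
  let ι := {J : Finset Γ // (J : Set Γ) ⊆ Iᶜ}
  have : Nonempty ι := ⟨⟨∅, by simp⟩⟩
  have hdir : Directed (· ≤ ·) fun J : ι => StarAlgebra.adjoin ℂ (c '' (J : Set Γ)) := fun J K =>
    ⟨⟨J ∪ K, by simpa using ⟨J.2, K.2⟩⟩,
      StarAlgebra.adjoin_mono (Set.image_mono (by simp)),
      StarAlgebra.adjoin_mono (Set.image_mono (by simp))⟩
  obtain ⟨T, hTα, hTadj⟩ := exists_extension_of_norm_eq (α := α) hdir
    ((range_starSubalgebra_subtype (fermionRegion c I)).symm ▸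
      dense_iSup_fermionRegion_sup_adjoin I h)
    fun J _ hp => h.norm_fst_eq_norm_snd hα (Set.disjoint_left.mpr fun _ hi hi' => J.2 hi' hi) hp
  refine ⟨T, hTα, fermionRegion_le (T := StarAlgHom.equalizer (T : A →⋆ₐ[ℂ] A) (.id ℂ A))
    (isClosed_starAlgHom_equalizer _ _) fun i hi => ?_⟩
  exact hTadj ⟨{i}, by simpa using hi⟩ _ (StarAlgebra.subset_adjoin ℂ _ ⟨i, by simp, rfl⟩)

end Extension

end IsFermionSystem

theorem proposition6_general {Γ : Type*} [DecidableEq Γ] {I K : Set Γ} (hIK : Disjoint I K) :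
    (∀ (A : Type*) [CStarAlgebra A] (S : QuantumSpinSystem Γ A)
      (αI : S.region I ≃⋆ₐ[ℂ] S.region I) (αK : S.region K ≃⋆ₐ[ℂ] S.region K),
      ∃ α : A ≃⋆ₐ[ℂ] A, IsProductExtension αI αK α) ∧
    (∀ (A : Type*) [CStarAlgebra A] (c : Γ → A) (hc : IsFermionSystem c)
      (αI : fermionRegion c I ≃⋆ₐ[ℂ] fermionRegion c I)
      (αK : fermionRegion c K ≃⋆ₐ[ℂ] fermionRegion c K),
      (∀ a, αI (hc.grading I a) = hc.grading I (αI a)) →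
      (∀ b, αK (hc.grading K b) = hc.grading K (αK b)) →
      ∃ α : A ≃⋆ₐ[ℂ] A, IsProductExtension αI αK α) := by
  have hK : K ⊆ Iᶜ := hIK.subset_compl_left
  have hI : I ⊆ Kᶜ := hIK.subset_compl_right
  constructor
  · intro A _ S αI αK
    obtain ⟨TI, hTI, hTI'⟩ := S.exists_extension αI
    obtain ⟨TK, hTK, hTK'⟩ := S.exists_extension αK
    exact ⟨_, .of_extensions hTI (fun b hb => hTI' b (S.region_mono hK hb)) hTK
      fun a ha => hTK' a (S.region_mono hI ha)⟩
  · intro A _ c hc αI αK hαI hαK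
    obtain ⟨TI, hTI, hTI'⟩ := hc.exists_extension αI hαI
    obtain ⟨TK, hTK, hTK'⟩ := hc.exists_extension αK hαK
    exact ⟨_, .of_extensions hTI (fun b hb => hTI' b (fermionRegion_mono hK hb)) hTK
      fun a ha => hTK' a (fermionRegion_mono hI ha)⟩

theorem proposition6 :
    -- quantum spin lattice systems
    (∀ (A : Type*) [CStarAlgebra A] (S : QuantumSpinSystem ℤ A)
      (αL : S.region leftHalf ≃⋆ₐ[ℂ] S.region leftHalf)
      (αR : S.region rightHalf ≃⋆ₐ[ℂ] S.region rightHalf),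
      ∃ α : A ≃⋆ₐ[ℂ] A, IsProductExtension αL αR α) ∧
    -- fermion lattice systems
    (∀ (A : Type*) [CStarAlgebra A] (c : ℤ → A) (hc : IsFermionSystem c)
      (αL : fermionRegion c leftHalf ≃⋆ₐ[ℂ] fermionRegion c leftHalf)
      (αR : fermionRegion c rightHalf ≃⋆ₐ[ℂ] fermionRegion c rightHalf),
      (∀ a, αL (hc.grading leftHalf a) = hc.grading leftHalf (αL a)) →
      (∀ b, αR (hc.grading rightHalf b) = hc.grading rightHalf (αR b)) →
      ∃ α : A ≃⋆ₐ[ℂ] A, IsProductExtension αL αR α) :=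
  proposition6_general <| Set.Iio_disjoint_Ici le_rfl
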